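/- Let $d\ge 2$, $\mathbb{T}^d=\mathbb{R}^d/2\pi\mathbb{Z}^d$ with canonical projection $\mathfrak{p}:\mathbb{R}^d\to\mathbb{T}^d$, and $S\mathbb{T}^d=\mathbb{T}^d\times\mathbb{S}^{d-1}$ with geodesic flow $e^{tV}(x,\theta)=(x+t\theta,\theta)$. Call a nonempty compact convex set $K\subset\mathbb{R}^d$ strictly convex with smooth boundary if either $K$ is a single point, or $\partial K=K\setminus\mathring{K}$ is a smooth hypersurface whose second fundamental form with respect to the outward normal is everywhere positive definite. A set $\Sigma\subset\mathbb{T}^d$ is admissible if $\Sigma=\mathfrak{p}(\partial K)$ for such a $K$. For $\sigma\in\{+,-\}$ put $$N_\sigma(\Sigma)=\{(\mathfrak{p}(x),\sigma\theta):\ x\in\partial K,\ \theta\in\mathbb{S}^{d-1}\text{ an outward unit normal to }K\text{ at }x\},$$ where every $\theta\in\mathbb{S}^{d-1}$ is an outward unit normal when $K$ is a point. Let $\Sigma_1=\mathfrak{p}(\partial K_1)$ and $\Sigma_2=\mathfrak{p}(\partial K_2)$ be admissible, let $\sigma_1,\sigma_2\in\{+,-\}$, and for $t>0$ let $$\mathcal{E}_t(\Sigma_1,\Sigma_2)=N_{\sigma_1}(\Sigma_1)\cap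 e^{tV}\big(N_{\sigma_2}(\Sigma_2)\big),$$ whose elements correspond to the geodesic arcs of length $t$ from $\Sigma_2$ to $\Sigma_1$ that are directly orthogonal to both. Then there exists $T_0>0$ such that $\mathcal{E}_t(\Sigma_1,\Sigma_2)$ is finite for every $t\ge T_0$, is nonempty for only finitely many $t$ in each bounded interval $[T_0,T]$, and, as $T\to+\infty$, $$\sum_{T_0\le t\le T}\sharp\,\mathcal{E}_t(\Sigma_1,\Sigma_2)=\frac{\pi^{d/2}\,T^d}{(2\pi)^d\,\Gamma\left(\frac d2+1\right)}+\mathcal{O}(T^{d-1}).$$ -/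

import Mathlib

open Set Filter Asymptotics
open scoped Real ContDiff Topology

namespace Orthogeodesic

/-- `K` is a closed region whose boundary is smooth with positive curvature: near each boundary
point `x`, `K` is the sublevel set `{ρ ≤ 0}` of a smooth function `ρ` with `dρ(x) ≠ 0`, so that
`ker dρ(x)` is the tangent space of `∂K` at `x`, the outward normal is `∇ρ(x)/|∇ρ(x)|`, and the
second fundamental form of `∂K` at `x` is `D²ρ(x)/|∇ρ(x)|` restricted to `ker dρ(x)`. It is
required to be positive definite (all principal curvatures are positive). -/
def HasSmoothPosCurvedBoundary {d : ℕ} (K : Set (EuclideanSpace ℝ (Fin d))) : Prop :=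
  ∀ x ∈ frontier K, ∃ (U : Set (EuclideanSpace ℝ (Fin d))) (ρ : EuclideanSpace ℝ (Fin d) → ℝ),
    IsOpen U ∧ x ∈ U ∧ ContDiffOn ℝ ∞ ρ U ∧ K ∩ U = {y ∈ U | ρ y ≤ 0} ∧
    fderiv ℝ ρ x ≠ 0 ∧
    ∀ v : EuclideanSpace ℝ (Fin d), v ≠ 0 → fderiv ℝ ρ x v = 0 →
      0 < fderiv ℝ (fderiv ℝ ρ) x v v

/-- Strictly convex compact subsets of `ℝ^d` with smooth boundary: nonempty compact convex sets
which either have a smooth boundary of positive curvature, or are reduced to a point. -/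
structure IsStrictlyConvexSmooth {d : ℕ} (K : Set (EuclideanSpace ℝ (Fin d))) : Prop where
  nonempty : K.Nonempty
  isCompact : IsCompact K
  convex : Convex ℝ K
  boundary : (∃ x₀, K = {x₀}) ∨ HasSmoothPosCurvedBoundary K

/-- The flat torus `𝕋^d = ℝ^d / 2πℤ^d`. -/
abbrev Torus (d : ℕ) : Type := Fin d → AddCircle (2 * π)

/-- The canonical projection `𝔭 : ℝ^d → 𝕋^d`. -/
noncomputable def proj {d : ℕ} (x : EuclideanSpace ℝ (Fin d)) : Torus d :=
  fun i => ((x i : ℝ) : AddCircle (2 * π))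

/-- The unit sphere `𝕊^{d-1}` of `ℝ^d`. -/
abbrev UnitSphere (d : ℕ) : Type := Metric.sphere (0 : EuclideanSpace ℝ (Fin d)) 1

/-- `S` is an admissible subset of the torus, realized as `S = 𝔭(∂K)` for the strictly convex
compact set `K` with smooth boundary, where `∂K = K \ int K`. -/
def IsAdmissibleVia {d : ℕ} (S : Set (Torus d)) (K : Set (EuclideanSpace ℝ (Fin d))) : Prop :=
  IsStrictlyConvexSmooth K ∧ proj '' (K \ interior K) = S

/-- The direct (outward) unit normal bundle of a convex set `K`: the pairs `(x, θ)` with `x ∈ ∂K`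
and `θ` an outward unit normal vector to `K` at `x`. If `K = {x₀}`, every unit vector is an
outward normal at `x₀`. -/
def outerNormalBundle {d : ℕ} (K : Set (EuclideanSpace ℝ (Fin d))) :
    Set (EuclideanSpace ℝ (Fin d) × UnitSphere d) :=
  {q | q.1 ∈ K \ interior K ∧
    ∀ y ∈ K, inner ℝ (y - q.1) (q.2 : EuclideanSpace ℝ (Fin d)) ≤ 0}

/-- A choice of orientation: `outward` is the sign `+`, `inward` is the sign `-`. -/
inductive NormalSign : Type
  | outward
  | inward

/-- The unit vector `σθ`. -/
noncomputable def NormalSign.apply {d : ℕ} : NormalSign → UnitSphere d → UnitSphere d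
  | outward, θ => θ
  | inward, θ => -θ

/-- The unit normal bundle `N_σ(Σ) ⊂ S𝕋^d = 𝕋^d × 𝕊^{d-1}` of `Σ = 𝔭(∂K)`: the points
`(𝔭(x), σθ)`, where `θ` is an outward unit normal to `K` at `x ∈ ∂K`. -/
def normalBundle {d : ℕ} (σ : NormalSign) (K : Set (EuclideanSpace ℝ (Fin d))) :
    Set (Torus d × UnitSphere d) :=
  (fun q => (proj q.1, σ.apply q.2)) '' outerNormalBundle K

/-- The geodesic flow `e^{tV}(x, θ) = (x + tθ, θ)` on `S𝕋^d`. -/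
noncomputable def geodesicFlow {d : ℕ} (t : ℝ) (q : Torus d × UnitSphere d) :
    Torus d × UnitSphere d :=
  (q.1 + proj (t • (q.2 : EuclideanSpace ℝ (Fin d))), q.2)

/-- `𝓔_t(Σ₁, Σ₂) = N_{σ₁}(Σ₁) ∩ e^{tV}(N_{σ₂}(Σ₂))`: the end vectors of the geodesic arcs of
length `t` going from `Σ₂` to `Σ₁` that are directly orthogonal to both. -/
def orthogeodesics {d : ℕ} (σ₁ σ₂ : NormalSign) (K₁ K₂ : Set (EuclideanSpace ℝ (Fin d)))
    (t : ℝ) : Set (Torus d × UnitSphere d) :=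
  normalBundle σ₁ K₁ ∩ geodesicFlow t '' normalBundle σ₂ K₂

end Orthogeodesic

open Orthogeodesic

namespace Orthogeodesic

/-! Positive curvature makes the inverse Gauss map Lipschitz: each direction is an outward normal at
exactly one point of `∂K`. Hence each signed normal bundle is a graph `θ ↦ (𝔭(gᵢ θ), θ)` with `gᵢ`
bounded and Lipschitz (`exists_normalBundle_eq_range`). With `G = g₁ - g₂`, the elements of `𝓔_t`
correspond to the directions `θ` for which `tθ - G(θ)` lies in `2πℤ^d` (`orthogeodesics_eq_image`).

Let `L` and `M` be a Lipschitz constant and a bound for `G`. For `t ≥ T₀ > 2L`, the map `(t, θ) ↦ tθ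
- G(θ)` is a perturbation of polar coordinates: it is injective (`polarShift_injOn`), it reaches
every point of norm at least `T₀ + M` (`exists_polarShift_eq`, by contraction), and it changes norms
by at most `M`. The sum up to `T` therefore lies between the numbers of lattice points in the balls
of radius `T - M` and `T + M`, up to a constant. Comparing volumes of balls with unions of lattice
cells gives the main term and the error `O(T^{d-1})`. -/

/-! ### Quantitative strict convexity -/

theorem add_quadratic_le_of_le_deriv_deriv {φ φ' φ'' : ℝ → ℝ} {r m : ℝ} (hr : 0 ≤ r)
    (h1 : ∀ s ∈ Icc 0 r, HasDerivAt φ (φ' s) s) (h2 : ∀ s ∈ Icc 0 r, HasDerivAt φ' (φ'' s) s)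
    (hm : ∀ s ∈ Icc 0 r, m ≤ φ'' s) : φ 0 + φ' 0 * r + m / 2 * r ^ 2 ≤ φ r := by
  have e1 : ∀ s ∈ Icc 0 r, HasDerivAt (fun s => φ' s - m * s) (φ'' s - m) s := fun s hs => by
    simpa using (h2 s hs).fun_sub ((hasDerivAt_id s).const_mul m)
  have mono1 : MonotoneOn (fun s => φ' s - m * s) (Icc 0 r) := by
    refine monotoneOn_of_deriv_nonneg (convex_Icc _ _)
      (fun s hs => (e1 s hs).continuousAt.continuousWithinAt)
      (fun s hs => (e1 s (interior_subset hs)).differentiableAt.differentiableWithinAt) ?_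
    intro s hs
    rw [(e1 s (interior_subset hs)).deriv]
    linarith [hm s (interior_subset hs)]
  have e2 : ∀ s ∈ Icc 0 r, HasDerivAt (fun s => φ s - φ' 0 * s - m / 2 * s ^ 2)
      (φ' s - φ' 0 - m * s) s := fun s hs => by
    refine (((h1 s hs).sub ((hasDerivAt_id s).const_mul (φ' 0))).sub
      (((hasDerivAt_id s).pow 2).const_mul (m / 2))).congr_deriv ?_
    simp; ring
  have mono2 : MonotoneOn (fun s => φ s - φ' 0 * s - m / 2 * s ^ 2) (Icc 0 r) := by
    refine monotoneOn_of_deriv_nonneg (convex_Icc _ _)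
      (fun s hs => (e2 s hs).continuousAt.continuousWithinAt)
      (fun s hs => (e2 s (interior_subset hs)).differentiableAt.differentiableWithinAt) ?_
    intro s hs
    have hs' := interior_subset hs
    rw [(e2 s hs').deriv]
    have := mono1 (left_mem_Icc.2 hr) hs' hs'.1
    simp only at this
    linarith
  have := mono2 (left_mem_Icc.2 hr) (right_mem_Icc.2 hr) hr
  simp only at this
  nlinarith

theorem eq_zero_of_mem_diff_interior {E : Type*} [TopologicalSpace E] {K U : Set E}
    {ρ : E → ℝ} {x : E} (hU : IsOpen U)
    (hxU : x ∈ U) (hKU : K ∩ U = {y ∈ U | ρ y ≤ 0}) (hρ : ContinuousAt ρ x)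
    (hx : x ∈ K \ interior K) : ρ x = 0 := by
  have h0 : ρ x ≤ 0 := (hKU.subset ⟨hx.1, hxU⟩).2
  refine le_antisymm h0 (not_lt.1 fun hlt => hx.2 ?_)
  rw [mem_interior_iff_mem_nhds]
  filter_upwards [hU.mem_nhds hxU, hρ.eventually (gt_mem_nhds hlt)] with y hy hy'
  exact (hKU.superset ⟨hy, hy'.le⟩).1

section Local

variable {E : Type*} [NormedAddCommGroup E] [InnerProductSpace ℝ E]

/-- At a boundary point, the differential of a defining function is a positive multiple of any
outward unit normal. -/
theorem fderiv_eq_of_normal [CompleteSpace E] {K U : Set E} {ρ : E → ℝ} {x θ : E} (hU : IsOpen U)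
    (hxU : x ∈ U) (hKU : K ∩ U = {y ∈ U | ρ y ≤ 0}) (hρ : DifferentiableAt ℝ ρ x)
    (hd : fderiv ℝ ρ x ≠ 0) (hx : x ∈ K) (hθ : ‖θ‖ = 1)
    (hn : ∀ y ∈ K, inner ℝ (y - x) θ ≤ 0) :
    0 < fderiv ℝ ρ x θ ∧ ∀ v, fderiv ℝ ρ x v = fderiv ℝ ρ x θ * inner ℝ v θ := by
  have h0 : ρ x ≤ 0 := (hKU.subset ⟨hx, hxU⟩).2
  -- A direction along which `ρ` decreases to first order enters `K`, where the normal inequality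
  -- applies.
  have key : ∀ v, fderiv ℝ ρ x v < 0 → inner ℝ v θ ≤ 0 := by
    intro v hv
    have hline : HasDerivAt (fun s : ℝ => x + s • v) v 0 := by
      simpa using ((hasDerivAt_id (0 : ℝ)).smul_const v).const_add x
    have hder : HasDerivAt (fun s : ℝ => ρ (x + s • v)) (fderiv ℝ ρ x v) 0 := by
      have : HasFDerivAt ρ (fderiv ℝ ρ x) (x + (0 : ℝ) • v) := by simpa using hρ.hasFDerivAt
      exact this.comp_hasDerivAt 0 hline
    have hsl := (hasDerivAt_iff_tendsto_slope.1 hder).eventually (gt_mem_nhds hv)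
    have hsl' : ∀ᶠ s in 𝓝[>] (0 : ℝ), slope (fun s : ℝ => ρ (x + s • v)) 0 s < 0 :=
      hsl.filter_mono (nhdsWithin_mono _ fun s hs => ne_of_gt hs)
    have hUe : ∀ᶠ s in 𝓝[>] (0 : ℝ), x + s • v ∈ U := by
      refine Filter.Eventually.filter_mono nhdsWithin_le_nhds (hline.continuousAt.eventually ?_)
      simpa using hU.mem_nhds hxU
    obtain ⟨s, hs1, hs2, hs3⟩ := (hsl'.and (hUe.and self_mem_nhdsWithin)).exists
    have hs3 : 0 < s := hs3
    have hlt : ρ (x + s • v) < ρ x := by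
      rw [slope_def_field] at hs1
      simp only [sub_zero, zero_smul, add_zero] at hs1
      have := (div_neg_iff.1 hs1).resolve_left (fun h => by linarith [h.2])
      linarith [this.1]
    have hmem : x + s • v ∈ K := (hKU.superset ⟨hs2, (hlt.trans_le h0).le⟩).1
    have := hn _ hmem
    rw [add_sub_cancel_left, inner_smul_left] at this
    simp only [conj_trivial] at this
    exact nonpos_of_mul_nonpos_right this hs3
  set g : E := (InnerProductSpace.toDual ℝ E).symm (fderiv ℝ ρ x) with hg
  have hgv : ∀ v, fderiv ℝ ρ x v = inner ℝ g v := fun v => by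
    rw [hg, InnerProductSpace.toDual_symm_apply]
  have hg0 : g ≠ 0 := by simpa [hg] using hd
  have hgg : 0 < inner ℝ g g := real_inner_self_pos.2 hg0
  -- Tangent directions are limits of entering ones: tilt `w` slightly towards `-g` and let the tilt
  -- vanish.
  have hperp : ∀ w, inner ℝ g w = 0 → inner ℝ w θ ≤ 0 := by
    intro w hw
    refine le_of_forall_pos_le_add fun ε hε => ?_
    have hε' : 0 < ε / (|inner ℝ g θ| + 1) := by positivity
    have := key (w - (ε / (|inner ℝ g θ| + 1)) • g) (by
      rw [hgv, inner_sub_right, inner_smul_right, hw]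
      nlinarith [mul_pos hε' hgg])
    rw [inner_sub_left, inner_smul_left] at this
    simp only [conj_trivial] at this
    have h3 : ε / (|inner ℝ g θ| + 1) * inner ℝ g θ ≤ ε := by
      rw [div_mul_eq_mul_div, div_le_iff₀ (by positivity)]
      nlinarith [le_abs_self (inner ℝ g θ)]
    linarith
  have hθθ : inner ℝ θ θ = (1 : ℝ) := by rw [real_inner_self_eq_norm_sq, hθ]; norm_num
  obtain ⟨a, ha⟩ : ∃ a : ℝ, a = inner ℝ g θ / inner ℝ g g := ⟨_, rfl⟩
  have hag : a * inner ℝ g g = inner ℝ g θ := by rw [ha]; field_simp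
  -- The component of `θ` orthogonal to `g` is tangent, and its inner product with `θ` is its own
  -- squared norm, so it vanishes.
  have hw0 : θ - a • g = 0 := by
    have hgw : inner ℝ g (θ - a • g) = 0 := by
      rw [inner_sub_right, inner_smul_right, hag, sub_self]
    have h := hperp _ hgw
    have h2 : inner ℝ (θ - a • g) (θ - a • g) = inner ℝ (θ - a • g) θ := by
      conv_lhs => rw [inner_sub_right, inner_smul_right, real_inner_comm g, hgw, mul_zero, sub_zero]
    exact inner_self_eq_zero.1 (le_antisymm (h2.trans_le h) real_inner_self_nonneg)
  have hθg : θ = a • g := sub_eq_zero.1 hw0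
  have hneg : -(inner ℝ g θ) ≤ 0 := by
    have := key (-g) (by rw [hgv, inner_neg_right]; linarith)
    rwa [inner_neg_left] at this
  have ha1 : a * inner ℝ g θ = 1 := by
    rw [← hθθ]; conv_rhs => rw [hθg]
    rw [inner_smul_left, ← hθg]; simp
  have hpos : 0 < inner ℝ g θ := by
    refine lt_of_le_of_ne (by linarith) fun h => ?_
    rw [← h] at ha1; simp at ha1
  refine ⟨by rwa [hgv], fun v => ?_⟩
  have hvθ : inner ℝ v θ = a * inner ℝ g v := by
    conv_lhs => rw [hθg]
    rw [inner_smul_right, real_inner_comm]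
  rw [hgv, hgv, hvθ]
  linear_combination -(inner ℝ g v) * ha1

/-- Second-order lower bound for a smooth function near a point and a direction in which its
Hessian is positive. -/
theorem exists_quadratic_lower_bound {U : Set E} {ρ : E → ℝ} {x u : E} (hU : IsOpen U)
    (hxU : x ∈ U) (hρ : ContDiffOn ℝ ∞ ρ U) (hu : 0 < fderiv ℝ (fderiv ℝ ρ) x u u) :
    ∃ m > 0, ∃ δ > 0, Metric.ball x δ ⊆ U ∧
      ∀ p w : E, ∀ r : ℝ, 0 ≤ r → dist p x < δ → dist (p + r • w) x < δ → dist w u < δ →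
        ρ p + fderiv ℝ ρ p w * r + m * r ^ 2 ≤ ρ (p + r • w) := by
  have hf1 : ContDiffOn ℝ ∞ (fderiv ℝ ρ) U := hρ.fderiv_of_isOpen hU (by simp)
  have hf2 : ContinuousOn (fderiv ℝ (fderiv ℝ ρ)) U :=
    hf1.continuousOn_fderiv_of_isOpen hU (by simp)
  have hc : ContinuousAt (fun z : E × E => fderiv ℝ (fderiv ℝ ρ) z.1 z.2 z.2) (x, u) := by
    have h1 : ContinuousAt (fun z : E × E => fderiv ℝ (fderiv ℝ ρ) z.1) (x, u) :=
      ContinuousAt.comp (f := Prod.fst) (hf2.continuousAt (hU.mem_nhds hxU)) continuousAt_fst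
    exact (h1.clm_apply continuousAt_snd).clm_apply continuousAt_snd
  set m0 := fderiv ℝ (fderiv ℝ ρ) x u u with hm0
  have hev := hc.eventually (lt_mem_nhds (show m0 / 2 < m0 by linarith))
  obtain ⟨δ₁, hδ₁, hb1⟩ := Metric.eventually_nhds_iff.1 hev
  obtain ⟨δ₂, hδ₂, hb2⟩ := Metric.isOpen_iff.1 hU x hxU
  -- The Hessian stays above `m0 / 2` nearby; the Taylor factor `1/2` turns this into `m0 / 4`.
  refine ⟨m0 / 4, by linarith, min δ₁ δ₂, lt_min hδ₁ hδ₂,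
    (Metric.ball_subset_ball (min_le_right _ _)).trans hb2, ?_⟩
  intro p w r hr hp hq hw
  have hseg : ∀ s ∈ Icc 0 r, p + s • w ∈ Metric.ball x (min δ₁ δ₂) := by
    intro s hs
    rcases hr.eq_or_lt with rfl | hr'
    · have : s = 0 := le_antisymm hs.2 hs.1
      simpa [this] using hp
    have := (convex_ball x (min δ₁ δ₂)).add_smul_mem (x := p) (y := r • w) hp hq
      (t := s / r) ⟨div_nonneg hs.1 hr, div_le_one_of_le₀ hs.2 hr⟩
    rwa [smul_smul, div_mul_cancel₀ _ hr'.ne'] at this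
  have hline : ∀ s : ℝ, HasDerivAt (fun s : ℝ => p + s • w) w s := fun s => by
    simpa using ((hasDerivAt_id s).smul_const w).const_add p
  have hsU : ∀ s ∈ Icc 0 r, p + s • w ∈ U := fun s hs =>
    hb2 (Metric.ball_subset_ball (min_le_right _ _) (hseg s hs))
  have key := add_quadratic_le_of_le_deriv_deriv (φ := fun s => ρ (p + s • w))
    (φ' := fun s => fderiv ℝ ρ (p + s • w) w)
    (φ'' := fun s => fderiv ℝ (fderiv ℝ ρ) (p + s • w) w w) (m := m0 / 2) hr
    (fun s hs => ((hρ.differentiableOn (by simp)).differentiableAt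
      (hU.mem_nhds (hsU s hs))).hasFDerivAt.comp_hasDerivAt s (hline s))
    (fun s hs => by
      have := ((hf1.differentiableOn (by simp)).differentiableAt
        (hU.mem_nhds (hsU s hs))).hasFDerivAt.comp_hasDerivAt s (hline s)
      simpa using this.clm_apply (hasDerivAt_const s w))
    (fun s hs => by
      refine (hb1 (y := (p + s • w, w)) ?_).le
      rw [Prod.dist_eq]
      exact max_lt ((hseg s hs).trans_le (min_le_left _ _)) (hw.trans_le (min_le_left _ _)))
  simp only [zero_smul, add_zero] at key
  linarith

end Local
-- Compactness of the set of triples (boundary point, normal, chord direction) reduces the bound to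
-- a local one. Near a triple with `⟨w, θ⟩ < 0` it follows from boundedness of chord lengths; with
-- `⟨w, θ⟩ = 0`, from positivity of the Hessian in the tangent direction `w`; with `⟨w, θ⟩ > 0`, no
-- chord exists.
theorem exists_linear_bound_of_posCurved {d : ℕ} {K : Set (EuclideanSpace ℝ (Fin d))}
    (hK : IsCompact K) (hconv : Convex ℝ K) (hb : HasSmoothPosCurvedBoundary K) :
    ∃ c > 0, ∀ x ∈ K \ interior K, ∀ θ : EuclideanSpace ℝ (Fin d), ‖θ‖ = 1 →
      (∀ y ∈ K, inner ℝ (y - x) θ ≤ 0) → ∀ w : EuclideanSpace ℝ (Fin d), ‖w‖ = 1 →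
      ∀ r : ℝ, 0 < r → x + r • w ∈ K → c * r ≤ -inner ℝ w θ := by
  set Z : Set (EuclideanSpace ℝ (Fin d) × EuclideanSpace ℝ (Fin d) × EuclideanSpace ℝ (Fin d)) :=
    ((K \ interior K) ×ˢ (Metric.sphere 0 1 ×ˢ Metric.sphere 0 1)) ∩
    {z | ∀ y ∈ K, inner ℝ (y - z.1) z.2.1 ≤ 0} with hZ
  have hZc : IsCompact Z := by
    refine IsCompact.inter_right ((hK.diff isOpen_interior).prod
      ((isCompact_sphere _ _).prod (isCompact_sphere _ _))) ?_
    have : {z : EuclideanSpace ℝ (Fin d) × EuclideanSpace ℝ (Fin d) × EuclideanSpace ℝ (Fin d) |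
        ∀ y ∈ K, inner ℝ (y - z.1) z.2.1 ≤ 0} =
        ⋂ y ∈ K, {z : EuclideanSpace ℝ (Fin d) × EuclideanSpace ℝ (Fin d) × EuclideanSpace ℝ (Fin d) |
          inner ℝ (y - z.1) z.2.1 ≤ 0} := by
      ext z; simp
    rw [this]
    exact isClosed_biInter fun y _ => isClosed_le (by fun_prop) continuous_const
  obtain ⟨D, hD0, hD⟩ : ∃ D : ℝ, 0 < D ∧ ∀ x ∈ K, ∀ y ∈ K, dist x y ≤ D := by
    obtain ⟨C, hC⟩ := Metric.isBounded_iff.1 hK.isBounded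
    exact ⟨max C 1, by positivity, fun x hx y hy => (hC hx hy).trans (le_max_left _ _)⟩
  suffices h : ∃ c > 0, ∀ z ∈ Z, ∀ r : ℝ, 0 < r → z.1 + r • z.2.2 ∈ K →
      c * r ≤ -inner ℝ z.2.2 z.2.1 by
    obtain ⟨c, hc, h⟩ := h
    refine ⟨c, hc, fun x hx θ hθ hn w hw r hr hy => h (x, θ, w) ⟨⟨hx, ?_, ?_⟩, hn⟩ r hr hy⟩ <;>
      simpa
  refine hZc.induction_on (p := fun s => ∃ c > 0, ∀ z ∈ s, ∀ r : ℝ, 0 < r → z.1 + r • z.2.2 ∈ K →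
      c * r ≤ -inner ℝ z.2.2 z.2.1) ⟨1, one_pos, by simp⟩ ?_ ?_ ?_
  · rintro s t hst ⟨c, hc, h⟩
    exact ⟨c, hc, fun z hz => h z (hst hz)⟩
  · rintro s t ⟨c, hc, h⟩ ⟨c', hc', h'⟩
    refine ⟨min c c', lt_min hc hc', ?_⟩
    rintro z (hz | hz) r hr hy
    · exact (mul_le_mul_of_nonneg_right (min_le_left _ _) hr.le).trans (h z hz r hr hy)
    · exact (mul_le_mul_of_nonneg_right (min_le_right _ _) hr.le).trans (h' z hz r hr hy)
  rintro ⟨x, θ, w⟩ ⟨⟨hx, hθ, hw⟩, hn⟩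
  simp only [mem_sphere_zero_iff_norm, mem_ofPred_eq] at hx hθ hw hn
  suffices h : ∃ c > 0, ∀ᶠ z in 𝓝 (x, θ, w), z ∈ Z → ∀ r : ℝ, 0 < r → z.1 + r • z.2.2 ∈ K →
      c * r ≤ -inner ℝ z.2.2 z.2.1 by
    obtain ⟨c, hc, h⟩ := h
    exact ⟨_, eventually_nhdsWithin_iff.2 h, c, hc, fun z hz => hz⟩
  have hrD : ∀ z ∈ Z, ∀ r : ℝ, 0 < r → z.1 + r • z.2.2 ∈ K → r ≤ D := by
    rintro ⟨x', θ', w'⟩ ⟨⟨hx', hθ', hw'⟩, hn'⟩ r hr hy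
    simp only [mem_sphere_zero_iff_norm] at hx' hw'
    have := hD _ hy _ hx'.1
    rwa [dist_self_add_left, norm_smul, hw', mul_one, Real.norm_of_nonneg hr.le] at this
  have hcont : ContinuousAt (fun z : EuclideanSpace ℝ (Fin d) × EuclideanSpace ℝ (Fin d) × EuclideanSpace ℝ (Fin d) =>
      (inner ℝ z.2.2 z.2.1 : ℝ)) (x, θ, w) :=
    Continuous.continuousAt (by fun_prop)
  rcases lt_trichotomy (inner ℝ w θ : ℝ) 0 with hlt | heq | hgt
  · refine ⟨-(inner ℝ w θ) / 2 / D, div_pos (by linarith) hD0, ?_⟩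
    filter_upwards [hcont.eventually (gt_mem_nhds (show (inner ℝ w θ : ℝ) < inner ℝ w θ / 2 by
      linarith))] with z hz hzZ r hr hy
    have := hrD z hzZ r hr hy
    have h2 : -(inner ℝ w θ) / 2 / D * r ≤ -(inner ℝ w θ) / 2 := by
      rw [div_mul_eq_mul_div, div_le_iff₀ hD0]
      exact mul_le_mul_of_nonneg_left this (by linarith)
    linarith
  · obtain ⟨U, ρ, hU, hxU, hρ, hKU, hd, hpos⟩ := hb x (by rwa [hK.isClosed.frontier_eq])
    have hdiff : ∀ y ∈ U, DifferentiableAt ℝ ρ y := fun y hy =>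
      (hρ.differentiableOn (by simp)).differentiableAt (hU.mem_nhds hy)
    have hw0 : w ≠ 0 := by rintro rfl; simp at hw
    have hdw : fderiv ℝ ρ x w = 0 := by
      rw [(fderiv_eq_of_normal hU hxU hKU (hdiff x hxU) hd hx.1 hθ hn).2 w, heq, mul_zero]
    obtain ⟨m, hm, δ, hδ, hδU, hquad⟩ :=
      exists_quadratic_lower_bound hU hxU hρ (hpos w hw0 hdw)
    have hf1 : ContinuousAt (fderiv ℝ ρ) x :=
      (hρ.continuousOn_fderiv_of_isOpen hU (by simp)).continuousAt (hU.mem_nhds hxU)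
    set C := ‖fderiv ℝ ρ x‖ + 1 with hC
    -- The chord may be too long for the local Taylor bound, so it is shortened by `κ`: `κ ≤ 1`
    -- keeps its endpoint in `K` by convexity, and `κ * D ≤ δ / 2` keeps it near `x`.
    set κ := min 1 (δ / (2 * D)) with hκ
    have hκ0 : 0 < κ := lt_min one_pos (by positivity)
    have hC0 : 0 < C := by positivity
    have hfst : Tendsto
        (fun z : EuclideanSpace ℝ (Fin d) × EuclideanSpace ℝ (Fin d) × EuclideanSpace ℝ (Fin d) => z.1)
        (𝓝 (x, θ, w)) (𝓝 x) := continuousAt_fst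
    have hsnd : Tendsto
        (fun z : EuclideanSpace ℝ (Fin d) × EuclideanSpace ℝ (Fin d) × EuclideanSpace ℝ (Fin d) => z.2.2)
        (𝓝 (x, θ, w)) (𝓝 w) :=
      Continuous.continuousAt (f := fun z :
        EuclideanSpace ℝ (Fin d) × EuclideanSpace ℝ (Fin d) × EuclideanSpace ℝ (Fin d) => z.2.2) (by fun_prop)
    refine ⟨m * κ / C, by positivity, ?_⟩
    filter_upwards [hfst.eventually (Metric.ball_mem_nhds x (half_pos hδ)),
      hsnd.eventually (Metric.ball_mem_nhds w hδ),
      hfst.eventually (hf1.eventually_ne hd),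
      hfst.eventually (hf1.norm.eventually (gt_mem_nhds (show ‖fderiv ℝ ρ x‖ < C by linarith)))]
    rintro ⟨x', θ', w'⟩ h1 h2 h3 h4 hzZ r hr hy
    have hrD' := hrD _ hzZ r hr hy
    obtain ⟨⟨hx', hθ', hw'⟩, hn'⟩ := hzZ
    simp only [mem_sphere_zero_iff_norm, mem_ofPred_eq] at *
    have hx'U : x' ∈ U := hδU (h1.trans (half_lt_self hδ))
    have hκr : κ * r ≤ δ / 2 := calc
      κ * r ≤ δ / (2 * D) * D :=
        mul_le_mul (min_le_right _ _) hrD' hr.le (by positivity)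
      _ = δ / 2 := by field_simp
    have hball : dist (x' + (κ * r) • w') x < δ := by
      have : dist (x' + (κ * r) • w') x' ≤ δ / 2 := by
        rwa [dist_self_add_left, norm_smul, hw', mul_one, Real.norm_of_nonneg (by positivity)]
      linarith [dist_triangle (x' + (κ * r) • w') x' x]
    have hyK : x' + (κ * r) • w' ∈ K := by
      have := hconv.add_smul_mem hx'.1 hy (t := κ) ⟨hκ0.le, min_le_left _ _⟩
      rwa [smul_smul] at this
    have hy0 := (hKU.subset ⟨hyK, hδU hball⟩).2
    have hx0 := eq_zero_of_mem_diff_interior hU hx'U hKU (hdiff x' hx'U).continuousAt hx'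
    have hq := hquad x' w' (κ * r) (by positivity) (h1.trans (half_lt_self hδ)) hball h2
    obtain ⟨hl0, hl⟩ := fderiv_eq_of_normal hU hx'U hKU (hdiff x' hx'U) h3 hx'.1 hθ' hn'
    have hlC : fderiv ℝ ρ x' θ' ≤ C := by
      have := (le_abs_self _).trans ((fderiv ℝ ρ x').le_opNorm θ')
      rw [hθ', mul_one] at this
      exact this.trans h4.le
    rw [hl w', hx0] at hq
    have hin : (inner ℝ w' θ' : ℝ) ≤ 0 := by
      have := hn' _ hy
      rw [add_sub_cancel_left, inner_smul_left] at this
      exact nonpos_of_mul_nonpos_right this hr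
    have hkr : 0 < κ * r := by positivity
    -- The Taylor bound, with `ρ = 0` at `x'` and `ρ ≤ 0` at the shortened endpoint, is divided by
    -- `κ * r`.
    have h5 : fderiv ℝ ρ x' θ' * inner ℝ w' θ' + m * (κ * r) ≤ 0 := by
      refine nonpos_of_mul_nonpos_left (b := κ * r) ?_ hkr
      nlinarith
    rw [div_mul_eq_mul_div, div_le_iff₀ hC0]
    nlinarith
  · refine ⟨1, one_pos, ?_⟩
    filter_upwards [hcont.eventually (lt_mem_nhds hgt)] with z hz hzZ r hr hy
    have := hzZ.2 _ hy
    rw [add_sub_cancel_left, inner_smul_left] at this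
    exact absurd (nonpos_of_mul_nonpos_right this hr) (not_le.2 hz)

/-- Uniform strict convexity: `K` lies inside uniform paraboloids at all its boundary points. -/
theorem exists_quadratic_bound_of_isStrictlyConvexSmooth {d : ℕ}
    {K : Set (EuclideanSpace ℝ (Fin d))} (hK : IsStrictlyConvexSmooth K) :
    ∃ c > 0, ∀ q ∈ outerNormalBundle K, ∀ y ∈ K,
      c * ‖q.1 - y‖ ^ 2 ≤ inner ℝ (q.1 - y) (q.2 : EuclideanSpace ℝ (Fin d)) := by
  rcases hK.boundary with ⟨x₀, rfl⟩ | hb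
  · refine ⟨1, one_pos, ?_⟩
    rintro ⟨x, θ⟩ ⟨hx, -⟩ y hy
    have h1 : x = x₀ := hx.1
    have h2 : y = x₀ := hy
    simp [h1, h2]
  · obtain ⟨c, hc, h⟩ := exists_linear_bound_of_posCurved hK.isCompact hK.convex hb
    refine ⟨c, hc, ?_⟩
    rintro ⟨x, θ⟩ ⟨hx, hn⟩ y hy
    dsimp only at *
    rcases eq_or_ne x y with rfl | hne
    · simp
    have hr : 0 < ‖y - x‖ := norm_pos_iff.2 (sub_ne_zero.2 hne.symm)
    have := h x hx θ (by simp) hn (‖y - x‖⁻¹ • (y - x))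
      (by rw [norm_smul, norm_inv, norm_norm, inv_mul_cancel₀ hr.ne']) ‖y - x‖ hr
      (by rwa [smul_smul, mul_inv_cancel₀ hr.ne', one_smul, add_sub_cancel])
    rw [inner_smul_left] at this
    simp only [conj_trivial] at this
    rw [norm_sub_rev, ← neg_sub y x, inner_neg_left]
    have h2 := mul_le_mul_of_nonneg_left this hr.le
    rw [mul_neg, mul_inv_cancel_left₀ hr.ne'] at h2
    linarith

/-! ### Inverse Gauss map and normal bundles as graphs -/

/-- The outward normal bundle of `K` is the graph of a bounded Lipschitz map on the sphere, the
inverse of the Gauss map. -/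
theorem exists_supportPoint {d : ℕ} {K : Set (EuclideanSpace ℝ (Fin d))}
    (hK : IsStrictlyConvexSmooth K) :
    ∃ f : UnitSphere d → EuclideanSpace ℝ (Fin d), (∃ L, ∀ θ θ', ‖f θ - f θ'‖ ≤ L * dist θ θ') ∧
      (∃ M, ∀ θ, ‖f θ‖ ≤ M) ∧ outerNormalBundle K = range fun θ => (f θ, θ) := by
  obtain ⟨c, hc, hq⟩ := exists_quadratic_bound_of_isStrictlyConvexSmooth hK
  have hex : ∀ θ : UnitSphere d, ∃ x, (x, θ) ∈ outerNormalBundle K := by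
    -- A maximizer over `K` of the linear form `⟨·, θ⟩` has normal `θ`; it is not interior, since
    -- moving along `θ` would increase the form.
    intro θ
    obtain ⟨x, hx, hmax⟩ := hK.isCompact.exists_isMaxOn hK.nonempty
      (f := fun y => (inner ℝ y (θ : EuclideanSpace ℝ (Fin d)) : ℝ))
      (Continuous.continuousOn (by fun_prop))
    refine ⟨x, ⟨hx, fun hint => ?_⟩, fun y hy => ?_⟩
    · have hcont : Tendsto (fun s : ℝ => x + s • (θ : EuclideanSpace ℝ (Fin d)))
          (𝓝[>] 0) (𝓝 x) := by
        have : ContinuousAt (fun s : ℝ => x + s • (θ : EuclideanSpace ℝ (Fin d))) 0 :=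
          Continuous.continuousAt (by fun_prop)
        have h := this.tendsto
        simp only [zero_smul, add_zero] at h
        exact h.mono_left nhdsWithin_le_nhds
      obtain ⟨s, hs, hs0⟩ := ((hcont.eventually (mem_interior_iff_mem_nhds.1 hint)).and
        self_mem_nhdsWithin).exists
      have h2 : inner ℝ (x + s • (θ : EuclideanSpace ℝ (Fin d))) (θ : EuclideanSpace ℝ (Fin d)) ≤
        (inner ℝ x (θ : EuclideanSpace ℝ (Fin d)) : ℝ) := hmax hs
      rw [inner_add_left, inner_smul_left, real_inner_self_eq_norm_sq] at h2
      simp only [norm_eq_of_mem_sphere, conj_trivial] at h2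
      have : 0 < s := hs0
      linarith
    · have h2 : (inner ℝ y (θ : EuclideanSpace ℝ (Fin d)) : ℝ) ≤
          inner ℝ x (θ : EuclideanSpace ℝ (Fin d)) := hmax hy
      rw [inner_sub_left]
      linarith
  choose f hf using hex
  -- Adding the paraboloid bounds at `f θ` and `f θ'` gives `2c‖f θ - f θ'‖² ≤ ⟨f θ - f θ', θ -
  -- θ'⟩`; Cauchy–Schwarz then yields the constant.
  refine ⟨f, ⟨(2 * c)⁻¹, fun θ θ' => ?_⟩, ?_, ?_⟩
  · have h1 := hq _ (hf θ) _ (hf θ').1.1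
    have h2 := hq _ (hf θ') _ (hf θ).1.1
    dsimp only at h1 h2
    rw [norm_sub_rev, ← neg_sub (f θ) (f θ'), inner_neg_left] at h2
    have h3 := (abs_real_inner_le_norm (f θ - f θ')
      ((θ : EuclideanSpace ℝ (Fin d)) - θ')).trans' (le_abs_self _)
    rw [inner_sub_right, ← dist_eq_norm (θ : EuclideanSpace ℝ (Fin d)), ← Subtype.dist_eq] at h3
    rw [inv_mul_eq_div, le_div_iff₀ (by positivity)]
    rcases (norm_nonneg (f θ - f θ')).eq_or_lt with h0 | h0
    · rw [← h0, zero_mul]; exact dist_nonneg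
    · refine le_of_mul_le_mul_left ?_ h0
      nlinarith
  · obtain ⟨M, hM⟩ := hK.isCompact.isBounded.exists_norm_le
    exact ⟨M, fun θ => hM _ (hf θ).1.1⟩
  · ext ⟨x, θ⟩
    constructor
    · intro h
      refine ⟨θ, Prod.ext ?_ rfl⟩
      -- Uniqueness of the support point: `c‖x - f θ‖² ≤ ⟨x - f θ, θ⟩ ≤ 0`.
      have h1 := hq _ h _ (hf θ).1.1
      have h2 := (hf θ).2 x h.1.1
      dsimp only at h1 h2 ⊢
      have h3 : ‖x - f θ‖ ^ 2 ≤ 0 := nonpos_of_mul_nonpos_right (h1.trans h2) hc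
      have h4 : ‖x - f θ‖ = 0 := by
        by_contra hne
        exact absurd h3 (not_le.2 (by positivity))
      exact (sub_eq_zero.1 (norm_eq_zero.1 h4)).symm
    · rintro ⟨θ', h⟩
      obtain ⟨rfl, rfl⟩ := Prod.ext_iff.1 h
      exact hf θ'

/-- The sign acts on the sphere as an isometric involution, so precomposing the inverse Gauss map
with it preserves both bounds. -/
theorem exists_normalBundle_eq_range {d : ℕ} {K : Set (EuclideanSpace ℝ (Fin d))}
    (hK : IsStrictlyConvexSmooth K) (σ : NormalSign) :
    ∃ g : UnitSphere d → EuclideanSpace ℝ (Fin d), (∃ L, ∀ θ θ', ‖g θ - g θ'‖ ≤ L * dist θ θ') ∧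
      (∃ M, ∀ θ, ‖g θ‖ ≤ M) ∧ normalBundle σ K = range fun θ => (proj (g θ), θ) := by
  obtain ⟨f, ⟨L, hL⟩, ⟨M, hM⟩, hf⟩ := exists_supportPoint hK
  have hσ : ∀ θ : UnitSphere d, σ.apply (σ.apply θ) = θ := by
    cases σ <;> simp [NormalSign.apply]
  refine ⟨fun θ => f (σ.apply θ), ⟨L, fun θ θ' => ?_⟩, ⟨M, fun θ => hM _⟩, ?_⟩
  · refine (hL _ _).trans_eq ?_
    cases σ <;> simp [NormalSign.apply, Subtype.dist_eq]
  · rw [normalBundle, hf, ← range_comp]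
    ext ⟨p, θ⟩
    constructor
    · rintro ⟨θ', h⟩
      refine ⟨σ.apply θ', ?_⟩
      simpa [hσ] using h
    · rintro ⟨θ', h⟩
      refine ⟨σ.apply θ', ?_⟩
      simpa [hσ] using h

/-! ### Lattice points in balls -/

/-- The lattice `2πℤ^d`. -/
def lattice (d : ℕ) : Set (EuclideanSpace ℝ (Fin d)) :=
  {ξ | ∃ n : Fin d → ℤ, ∀ i, ξ i = 2 * π * n i}

theorem proj_eq_proj_iff {d : ℕ} (x y : EuclideanSpace ℝ (Fin d)) :
    proj x = proj y ↔ x - y ∈ lattice d := by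
  have h : ∀ i, ((x i : AddCircle (2 * π)) = y i ↔ ∃ n : ℤ, (x - y) i = 2 * π * n) := by
    intro i
    rw [← sub_eq_zero, ← AddCircle.coe_sub, AddCircle.coe_eq_zero_iff]
    refine exists_congr fun n => ?_
    rw [zsmul_eq_mul, mul_comm, eq_comm, PiLp.sub_apply]
  simp only [proj, funext_iff, h, lattice, mem_ofPred_eq]
  exact ⟨fun h => ⟨fun i => (h i).choose, fun i => (h i).choose_spec⟩, fun ⟨n, h⟩ i => ⟨n i, h i⟩⟩

/-- The half-open cube of side `2π` with lowest corner `ξ`. -/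
def cell {d : ℕ} (ξ : EuclideanSpace ℝ (Fin d)) : Set (EuclideanSpace ℝ (Fin d)) :=
  (fun x i => x i) ⁻¹' (univ.pi fun i => Ico (ξ i) (ξ i + 2 * π))

theorem mem_cell {d : ℕ} {ξ x : EuclideanSpace ℝ (Fin d)} :
    x ∈ cell ξ ↔ ∀ i, ξ i ≤ x i ∧ x i < ξ i + 2 * π := by
  simp [cell]

theorem measurableSet_cell {d : ℕ} (ξ : EuclideanSpace ℝ (Fin d)) : MeasurableSet (cell ξ) :=
  (PiLp.volume_preserving_ofLp (Fin d)).measurable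
    (MeasurableSet.univ_pi fun _ => measurableSet_Ico)

theorem volume_cell {d : ℕ} (ξ : EuclideanSpace ℝ (Fin d)) :
    MeasureTheory.volume (cell ξ) = ENNReal.ofReal ((2 * π) ^ d) := by
  have := (PiLp.volume_preserving_ofLp (Fin d)).measure_preimage
    (s := univ.pi fun i => Ico (ξ i) (ξ i + 2 * π))
    (MeasurableSet.univ_pi fun _ => measurableSet_Ico).nullMeasurableSet
  rw [Real.volume_pi_Ico] at this
  refine this.trans ?_
  simp [ENNReal.ofReal_pow Real.two_pi_pos.le]

theorem exists_lattice_mem_cell {d : ℕ} (x : EuclideanSpace ℝ (Fin d)) :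
    ∃ ξ ∈ lattice d, x ∈ cell ξ := by
  refine ⟨WithLp.toLp 2 fun i => 2 * π * (⌊x i / (2 * π)⌋ : ℤ), ⟨_, fun i => rfl⟩, ?_⟩
  rw [mem_cell]
  intro i
  have h1 := Int.floor_le (x i / (2 * π))
  have h2 := Int.lt_floor_add_one (x i / (2 * π))
  rw [le_div_iff₀ Real.two_pi_pos] at h1
  rw [div_lt_iff₀ Real.two_pi_pos] at h2
  dsimp only
  constructor <;> linarith

theorem eq_of_mem_cell {d : ℕ} {ξ η x : EuclideanSpace ℝ (Fin d)} (hξ : ξ ∈ lattice d)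
    (hη : η ∈ lattice d) (hxξ : x ∈ cell ξ) (hxη : x ∈ cell η) : ξ = η := by
  obtain ⟨n, hn⟩ := hξ
  obtain ⟨m, hm⟩ := hη
  rw [mem_cell] at hxξ hxη
  ext i
  rw [hn, hm]
  have h1 := hxξ i
  have h2 := hxη i
  rw [hn] at h1
  rw [hm] at h2
  have hpos := Real.two_pi_pos
  have e1 : (n i : ℝ) < m i + 1 := by
    refine lt_of_mul_lt_mul_left (a := 2 * π) ?_ hpos.le
    linarith
  have e2 : (m i : ℝ) < n i + 1 := by
    refine lt_of_mul_lt_mul_left (a := 2 * π) ?_ hpos.le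
    linarith
  have : n i = m i := by
    have e1' : n i < m i + 1 := by exact_mod_cast e1
    have e2' : m i < n i + 1 := by exact_mod_cast e2
    omega
  rw [this]

theorem norm_sub_le_of_mem_cell {d : ℕ} {ξ x : EuclideanSpace ℝ (Fin d)} (hx : x ∈ cell ξ) :
    ‖x - ξ‖ ≤ √(∑ _i : Fin d, (2 * π) ^ 2) := by
  rw [EuclideanSpace.norm_eq]
  refine Real.sqrt_le_sqrt (Finset.sum_le_sum fun i _ => ?_)
  have := mem_cell.1 hx i
  rw [Real.norm_eq_abs, PiLp.sub_apply]
  refine pow_le_pow_left₀ (abs_nonneg _) ?_ 2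
  rw [abs_le]
  constructor <;> linarith [Real.two_pi_pos]

theorem finite_lattice_inter_closedBall (d : ℕ) (R : ℝ) :
    (lattice d ∩ Metric.closedBall 0 R).Finite := by
  refine ((Set.finite_Icc (fun _ : Fin d => -⌈R⌉) (fun _ => ⌈R⌉)).image
    (fun n => WithLp.toLp 2 fun i => 2 * π * (n i : ℝ))).subset ?_
  rintro ξ ⟨⟨n, hn⟩, hξ⟩
  rw [mem_closedBall_zero_iff] at hξ
  have habs : ∀ i, |(n i : ℝ)| ≤ ⌈R⌉ := by
    intro i
    have h1 : |ξ i| ≤ R := (PiLp.norm_apply_le ξ i).trans hξ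
    rw [hn, abs_mul, abs_of_pos Real.two_pi_pos] at h1
    have h2 : (1 : ℝ) ≤ 2 * π := by linarith [Real.pi_gt_three]
    nlinarith [abs_nonneg (n i : ℝ), Int.le_ceil R]
  refine ⟨n, ⟨fun i => ?_, fun i => ?_⟩, ?_⟩
  · exact_mod_cast (abs_le.1 (habs i)).1
  · exact_mod_cast (abs_le.1 (habs i)).2
  · ext i
    exact (hn i).symm

/-- Volume bounds for the number of points of `2πℤ^d` in a ball. -/
theorem ncard_lattice_inter_closedBall_bounds {d : ℕ} (hd : 0 < d) :
    ∃ c, 0 ≤ c ∧ ∀ R, 0 ≤ R →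
      (2 * π) ^ d * ((lattice d ∩ Metric.closedBall 0 R).ncard : ℝ) ≤
        (R + c) ^ d * (√π ^ d / Real.Gamma ((d : ℝ) / 2 + 1)) ∧
      (c ≤ R → (R - c) ^ d * (√π ^ d / Real.Gamma ((d : ℝ) / 2 + 1)) ≤
        (2 * π) ^ d * ((lattice d ∩ Metric.closedBall 0 R).ncard : ℝ)) := by
  have : Nonempty (Fin d) := ⟨⟨0, hd⟩⟩
  -- The diagonal of a cell: cells with corner in the ball of radius `R` lie in the ball of radius
  -- `R + c` and cover that of radius `R - c`.
  set c := √(∑ _i : Fin d, (2 * π) ^ 2) with hc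
  have hc0 : 0 ≤ c := Real.sqrt_nonneg _
  set V := √π ^ d / Real.Gamma ((d : ℝ) / 2 + 1) with hV
  have hV0 : 0 ≤ V := by
    have : 0 < Real.Gamma ((d : ℝ) / 2 + 1) := Real.Gamma_pos_of_pos (by positivity)
    positivity
  refine ⟨c, hc0, fun R hR => ?_⟩
  have hfin := finite_lattice_inter_closedBall d R
  have hball : ∀ r : ℝ, 0 ≤ r → MeasureTheory.volume
      (Metric.closedBall (0 : EuclideanSpace ℝ (Fin d)) r) = ENNReal.ofReal (r ^ d * V) := by
    intro r hr
    rw [EuclideanSpace.volume_closedBall, Fintype.card_fin, ← ENNReal.ofReal_pow hr,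
      ← ENNReal.ofReal_mul (by positivity)]
  have hunion : MeasureTheory.volume (⋃ ξ ∈ hfin.toFinset, cell ξ) =
      ENNReal.ofReal ((2 * π) ^ d * ((lattice d ∩ Metric.closedBall 0 R).ncard : ℝ)) := by
    rw [MeasureTheory.measure_biUnion_finset]
    · simp only [volume_cell, Finset.sum_const, nsmul_eq_mul]
      rw [mul_comm ((2 * π) ^ d), ENNReal.ofReal_mul (by positivity), ENNReal.ofReal_natCast,
        Set.ncard_eq_toFinset_card _ hfin]
    · intro ξ hξ η hη hne
      rw [Function.onFun, Set.disjoint_left]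
      intro x hx hx'
      simp only [Finite.coe_toFinset] at hξ hη
      exact hne (eq_of_mem_cell hξ.1 hη.1 hx hx')
    · exact fun ξ _ => measurableSet_cell ξ
  constructor
  · have hsub : (⋃ ξ ∈ hfin.toFinset, cell ξ) ⊆ Metric.closedBall 0 (R + c) := by
      intro x hx
      simp only [mem_iUnion, Finite.mem_toFinset] at hx
      obtain ⟨ξ, ⟨-, hξ⟩, hx⟩ := hx
      rw [mem_closedBall_zero_iff] at hξ ⊢
      have := norm_sub_le_of_mem_cell hx
      linarith [norm_le_norm_add_norm_sub ξ x, norm_sub_rev x ξ]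
    have := MeasureTheory.measure_mono (μ := MeasureTheory.volume) hsub
    rw [hunion, hball _ (by linarith)] at this
    exact (ENNReal.ofReal_le_ofReal_iff (by positivity)).1 this
  · intro hcR
    have hsub : Metric.closedBall 0 (R - c) ⊆ (⋃ ξ ∈ hfin.toFinset, cell ξ) := by
      intro x hx
      obtain ⟨ξ, hξ, hxξ⟩ := exists_lattice_mem_cell x
      simp only [mem_iUnion, Finite.mem_toFinset]
      refine ⟨ξ, ⟨hξ, ?_⟩, hxξ⟩
      rw [mem_closedBall_zero_iff] at hx ⊢
      have := norm_sub_le_of_mem_cell hxξ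
      linarith [norm_le_norm_add_norm_sub x ξ]
    have := MeasureTheory.measure_mono (μ := MeasureTheory.volume) hsub
    rw [hunion, hball _ (by linarith)] at this
    exact (ENNReal.ofReal_le_ofReal_iff (by positivity)).1 this

/-! ### Perturbed polar coordinates -/

theorem norm_normalize_sub_normalize_le {E : Type*} [NormedAddCommGroup E] [NormedSpace ℝ E]
    {x y : E} (hx : x ≠ 0) (hy : y ≠ 0) :
    ‖‖x‖⁻¹ • x - ‖y‖⁻¹ • y‖ ≤ 2 / ‖x‖ * ‖x - y‖ := by
  have hx' := norm_pos_iff.2 hx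
  have hy' := norm_pos_iff.2 hy
  have h : ‖x‖⁻¹ • x - ‖y‖⁻¹ • y = ‖x‖⁻¹ • ((x - y) + (‖y‖ - ‖x‖) • (‖y‖⁻¹ • y)) := by
    rw [smul_add, smul_sub, sub_smul, smul_sub, smul_smul ‖y‖, mul_inv_cancel₀ hy'.ne', one_smul,
      smul_smul ‖x‖⁻¹ ‖x‖, inv_mul_cancel₀ hx'.ne', one_smul]
    abel
  rw [h, norm_smul, norm_inv, norm_norm, div_mul_eq_mul_div, inv_mul_eq_div]
  gcongr
  refine (norm_add_le _ _).trans ?_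
  rw [norm_smul, norm_smul, norm_inv, norm_norm, inv_mul_cancel₀ hy'.ne', mul_one,
    Real.norm_eq_abs]
  have := abs_norm_sub_norm_le y x
  rw [norm_sub_rev] at this
  linarith

/-- The map `(t, θ) ↦ tθ - G(θ)`. -/
noncomputable def polarShift {d : ℕ} (G : UnitSphere d → EuclideanSpace ℝ (Fin d))
    (p : ℝ × UnitSphere d) : EuclideanSpace ℝ (Fin d) :=
  p.1 • (p.2 : EuclideanSpace ℝ (Fin d)) - G p.2

section PolarShift

variable {d : ℕ} {G : UnitSphere d → EuclideanSpace ℝ (Fin d)} {L M T₀ : ℝ}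

theorem norm_smul_sphere {t : ℝ} (ht : 0 ≤ t) (θ : UnitSphere d) :
    ‖t • (θ : EuclideanSpace ℝ (Fin d))‖ = t := by
  rw [norm_smul, norm_eq_of_mem_sphere, mul_one, Real.norm_of_nonneg ht]

/-- Equal images give `tθ - t'θ' = G θ - G θ'`; normalizing, `dist θ θ' ≤ (2L / t) dist θ θ'` with
`2L / t < 1`, which forces `θ = θ'`. -/
theorem polarShift_injOn (hL : ∀ θ θ', ‖G θ - G θ'‖ ≤ L * dist θ θ') (h0 : 0 < T₀)
    (h2L : 2 * L < T₀) : InjOn (polarShift G) {p | T₀ ≤ p.1} := by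
  rintro ⟨t, θ⟩ ht ⟨t', θ'⟩ ht' h
  simp only [mem_ofPred_eq] at ht ht'
  have ht0 : 0 < t := h0.trans_le ht
  have ht0' : 0 < t' := h0.trans_le ht'
  have hn := norm_smul_sphere ht0.le θ
  have hn' := norm_smul_sphere ht0'.le θ'
  have hdiff : t • (θ : EuclideanSpace ℝ (Fin d)) - t' • (θ' : EuclideanSpace ℝ (Fin d)) =
      G θ - G θ' := by
    simp only [polarShift] at h
    rw [sub_eq_sub_iff_add_eq_add] at h ⊢
    rw [h, add_comm]
  have hθ : θ = θ' := by
    by_contra hne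
    have hd : 0 < dist θ θ' := dist_pos.2 hne
    have h1 := norm_normalize_sub_normalize_le (x := t • (θ : EuclideanSpace ℝ (Fin d)))
      (y := t' • (θ' : EuclideanSpace ℝ (Fin d))) (norm_pos_iff.1 (by rwa [hn]))
      (norm_pos_iff.1 (by rwa [hn']))
    rw [hn, hn', smul_smul, smul_smul, inv_mul_cancel₀ ht0.ne', inv_mul_cancel₀ ht0'.ne', one_smul,
      one_smul, ← dist_eq_norm, ← Subtype.dist_eq, hdiff, div_mul_eq_mul_div,
      le_div_iff₀ ht0] at h1
    nlinarith [hL θ θ']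
  subst hθ
  rw [sub_self, sub_eq_zero] at hdiff
  rw [← hn, hdiff, hn']

/-- Solving `tθ = ξ + G(θ)` means finding a fixed point on the sphere of the normalization of `ξ +
G(θ)`, then taking `t = ‖ξ + G(θ)‖`. Since this norm is at least `T₀`, the map contracts by `2L / T₀
< 1`. -/
theorem exists_polarShift_eq (hd : 0 < d) (hL : ∀ θ θ', ‖G θ - G θ'‖ ≤ L * dist θ θ')
    (hL0 : 0 ≤ L) (hM : ∀ θ, ‖G θ‖ ≤ M) (h0 : 0 < T₀) (h2L : 2 * L < T₀)
    {ξ : EuclideanSpace ℝ (Fin d)} (hξ : T₀ + M ≤ ‖ξ‖) :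
    ∃ p : ℝ × UnitSphere d, T₀ ≤ p.1 ∧ polarShift G p = ξ := by
  have hbig : ∀ θ, T₀ ≤ ‖ξ + G θ‖ := fun θ => by
    have := norm_sub_le_norm_add ξ (G θ)
    linarith [hM θ]
  have hne : ∀ θ, ξ + G θ ≠ 0 := fun θ => norm_pos_iff.1 (h0.trans_le (hbig θ))
  let F : UnitSphere d → UnitSphere d := fun θ => ⟨‖ξ + G θ‖⁻¹ • (ξ + G θ), by
    rw [mem_sphere_zero_iff_norm, norm_smul, norm_inv, norm_norm,
      inv_mul_cancel₀ (norm_ne_zero_iff.2 (hne θ))]⟩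
  have hF : ContractingWith (2 * L / T₀).toNNReal F := by
    refine ⟨?_, LipschitzWith.of_dist_le_mul fun θ θ' => ?_⟩
    · rw [Real.toNNReal_lt_one, div_lt_one h0]
      exact h2L
    · rw [Real.coe_toNNReal _ (by positivity), Subtype.dist_eq, dist_eq_norm]
      refine (norm_normalize_sub_normalize_le (hne θ) (hne θ')).trans ?_
      rw [add_sub_add_left_eq_sub]
      calc 2 / ‖ξ + G θ‖ * ‖G θ - G θ'‖ ≤ 2 / T₀ * (L * dist θ θ') := by
            gcongr
            · exact hbig θ
            · exact hL θ θ'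
        _ = 2 * L / T₀ * dist θ θ' := by ring
  have : Nonempty (UnitSphere d) := by
    have : Nontrivial (EuclideanSpace ℝ (Fin d)) :=
      Module.nontrivial_of_finrank_pos (R := ℝ) (by simpa using hd)
    exact (NormedSpace.sphere_nonempty.2 zero_le_one).to_subtype
  have : CompleteSpace (UnitSphere d) :=
    (Metric.isClosed_sphere.isComplete).completeSpace_coe
  have hfix : F (hF.fixedPoint F) = hF.fixedPoint F := hF.fixedPoint_isFixedPt
  set θ := hF.fixedPoint F
  refine ⟨(‖ξ + G θ‖, θ), hbig θ, ?_⟩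
  have : (θ : EuclideanSpace ℝ (Fin d)) = ‖ξ + G θ‖⁻¹ • (ξ + G θ) := by
    conv_lhs => rw [← hfix]
  simp only [polarShift]
  conv_lhs => enter [1, 2]; rw [this]
  rw [smul_smul, mul_inv_cancel₀ (norm_ne_zero_iff.2 (hne θ)), one_smul, add_sub_cancel_right]

/-- The parameters `(t, θ)`, `T₀ ≤ t ≤ T`, for which `tθ - G(θ)` is a lattice point. -/
def polarLatticePoints (G : UnitSphere d → EuclideanSpace ℝ (Fin d)) (T₀ T : ℝ) :
    Set (ℝ × UnitSphere d) :=
  {p | p.1 ∈ Icc T₀ T ∧ polarShift G p ∈ lattice d}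

theorem polarLatticePoints_injOn (hL : ∀ θ θ', ‖G θ - G θ'‖ ≤ L * dist θ θ') (h0 : 0 < T₀)
    (h2L : 2 * L < T₀) (T : ℝ) : InjOn (polarShift G) (polarLatticePoints G T₀ T) :=
  (polarShift_injOn hL h0 h2L).mono fun _ hp => hp.1.1

theorem mapsTo_polarLatticePoints (hM : ∀ θ, ‖G θ‖ ≤ M) (h0 : 0 < T₀) (T : ℝ) :
    MapsTo (polarShift G) (polarLatticePoints G T₀ T)
      (lattice d ∩ Metric.closedBall 0 (T + M)) := by
  rintro ⟨t, θ⟩ ⟨ht, hl⟩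
  refine ⟨hl, ?_⟩
  rw [mem_closedBall_zero_iff]
  have := norm_smul_sphere (h0.le.trans ht.1) θ
  exact (norm_sub_le _ _).trans (add_le_add (this.trans_le ht.2) (hM θ))

theorem finite_polarLatticePoints (hL : ∀ θ θ', ‖G θ - G θ'‖ ≤ L * dist θ θ')
    (hM : ∀ θ, ‖G θ‖ ≤ M) (h0 : 0 < T₀) (h2L : 2 * L < T₀) (T : ℝ) :
    (polarLatticePoints G T₀ T).Finite :=
  Finite.of_injOn (mapsTo_polarLatticePoints hM h0 T) (polarLatticePoints_injOn hL h0 h2L T)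
    (finite_lattice_inter_closedBall d _)

theorem ncard_polarLatticePoints_le (hL : ∀ θ θ', ‖G θ - G θ'‖ ≤ L * dist θ θ')
    (hM : ∀ θ, ‖G θ‖ ≤ M) (h0 : 0 < T₀) (h2L : 2 * L < T₀) (T : ℝ) :
    (polarLatticePoints G T₀ T).ncard ≤ (lattice d ∩ Metric.closedBall 0 (T + M)).ncard :=
  ncard_le_ncard_of_injOn _ (mapsTo_polarLatticePoints hM h0 T)
    (polarLatticePoints_injOn hL h0 h2L T) (finite_lattice_inter_closedBall d _)

theorem le_ncard_polarLatticePoints (hd : 0 < d) (hL : ∀ θ θ', ‖G θ - G θ'‖ ≤ L * dist θ θ')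
    (hL0 : 0 ≤ L) (hM : ∀ θ, ‖G θ‖ ≤ M) (h0 : 0 < T₀) (h2L : 2 * L < T₀) (T : ℝ) :
    (lattice d ∩ Metric.closedBall 0 (T - M)).ncard ≤
      (lattice d ∩ Metric.closedBall 0 (T₀ + M)).ncard + (polarLatticePoints G T₀ T).ncard := by
  have hfin := finite_polarLatticePoints hL hM h0 h2L T
  have hsub : lattice d ∩ Metric.closedBall 0 (T - M) ⊆
      (lattice d ∩ Metric.closedBall 0 (T₀ + M)) ∪
        polarShift G '' polarLatticePoints G T₀ T := by
    rintro ξ ⟨hξ, hξT⟩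
    rw [mem_closedBall_zero_iff] at hξT
    rcases le_total ‖ξ‖ (T₀ + M) with h | h
    · exact Or.inl ⟨hξ, mem_closedBall_zero_iff.2 h⟩
    · obtain ⟨p, hp, rfl⟩ := exists_polarShift_eq hd hL hL0 hM h0 h2L h
      refine Or.inr ⟨p, ⟨⟨hp, ?_⟩, hξ⟩, rfl⟩
      have h1 := norm_smul_sphere (h0.le.trans hp) p.2
      have h2 := norm_sub_norm_le (p.1 • (p.2 : EuclideanSpace ℝ (Fin d))) (G p.2)
      have h3 : ‖p.1 • (p.2 : EuclideanSpace ℝ (Fin d)) - G p.2‖ ≤ T - M := hξT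
      linarith [hM p.2]
  refine (ncard_le_ncard hsub
    ((finite_lattice_inter_closedBall d _).union (hfin.image _))).trans ?_
  refine (ncard_union_le _ _).trans ?_
  rw [(polarLatticePoints_injOn hL h0 h2L T).ncard_image]

end PolarShift

/-! ### Asymptotics of the count -/

theorem isBigO_add_pow_sub_pow (b : ℝ) (d : ℕ) :
    (fun T : ℝ => (T + b) ^ d - T ^ d) =O[atTop] fun T : ℝ => T ^ (d - 1) := by
  refine IsBigO.of_bound (|b| * d * 2 ^ (d - 1)) ?_
  filter_upwards [eventually_ge_atTop |b|, eventually_ge_atTop 0] with T hT hT0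
  rw [Real.norm_eq_abs, Real.norm_of_nonneg (pow_nonneg hT0 _)]
  have h := abs_pow_sub_pow_le (T + b) T d
  rw [add_sub_cancel_left] at h
  refine h.trans ?_
  rw [mul_assoc (|b| * d), ← mul_pow]
  gcongr
  refine max_le ((abs_add_le _ _).trans ?_) ?_ <;> rw [abs_of_nonneg hT0] <;> linarith

/-- Counting of lattice points in perturbed polar coordinates. -/
theorem isBigO_ncard_polarLatticePoints {d : ℕ} (hd : 0 < d)
    {G : UnitSphere d → EuclideanSpace ℝ (Fin d)} {L M T₀ : ℝ}
    (hL : ∀ θ θ', ‖G θ - G θ'‖ ≤ L * dist θ θ') (hL0 : 0 ≤ L) (hM : ∀ θ, ‖G θ‖ ≤ M)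
    (h0 : 0 < T₀) (h2L : 2 * L < T₀) :
    (fun T : ℝ => ((polarLatticePoints G T₀ T).ncard : ℝ) -
      π ^ ((d : ℝ) / 2) * T ^ d / ((2 * π) ^ d * Real.Gamma ((d : ℝ) / 2 + 1)))
      =O[atTop] fun T : ℝ => T ^ (d - 1) := by
  obtain ⟨c, hc0, hc⟩ := ncard_lattice_inter_closedBall_bounds hd
  set V := √π ^ d / Real.Gamma ((d : ℝ) / 2 + 1) with hV
  have hpi : π ^ ((d : ℝ) / 2) = √π ^ d := by
    rw [Real.sqrt_eq_rpow, ← Real.rpow_mul_natCast Real.pi_pos.le]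
    congr 1; ring
  set N₀ : ℝ :=
    ((lattice d ∩ Metric.closedBall 0 (T₀ + M) : Set (EuclideanSpace ℝ (Fin d))).ncard : ℝ) with hN₀
  set W := V / (2 * π) ^ d with hW
  have hmain : ∀ T : ℝ, π ^ ((d : ℝ) / 2) * T ^ d /
      ((2 * π) ^ d * Real.Gamma ((d : ℝ) / 2 + 1)) = W * T ^ d := by
    intro T
    rw [hpi, hW, hV, div_div, mul_comm (Real.Gamma _), div_mul_eq_mul_div]
  simp only [hmain]
  have hpos : 0 < (2 * π) ^ d := by positivity
  -- The error combines the shifts of radius `±(M + c)` with `N₀`, the lattice points near the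
  -- origin that the polar map may miss.
  have hO : (fun T : ℝ => |W * ((T + (M + c)) ^ d - T ^ d)| +
      |W * ((T + (-M - c)) ^ d - T ^ d)| + N₀) =O[atTop] fun T : ℝ => T ^ (d - 1) := by
    refine (((isBigO_add_pow_sub_pow _ d).const_mul_left W).norm_left.add
      ((isBigO_add_pow_sub_pow _ d).const_mul_left W).norm_left).add ?_
    refine IsBigO.of_bound N₀ ?_
    filter_upwards [eventually_ge_atTop 1] with T hT
    have h1 : 1 ≤ T ^ (d - 1) := one_le_pow₀ hT
    have hN : 0 ≤ N₀ := Nat.cast_nonneg _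
    rw [Real.norm_of_nonneg hN, Real.norm_of_nonneg (by linarith)]
    nlinarith
  refine IsBigO.trans (IsBigO.of_bound 1 ?_) hO
  filter_upwards [eventually_ge_atTop (M + c), eventually_ge_atTop (-M)] with T hT hT'
  have hup : ((polarLatticePoints G T₀ T).ncard : ℝ) ≤ W * (T + (M + c)) ^ d := by
    have h1 : ((polarLatticePoints G T₀ T).ncard : ℝ) ≤ _ :=
      Nat.cast_le.2 (ncard_polarLatticePoints_le hL hM h0 h2L T)
    have h2 := (hc (T + M) (by linarith)).1
    rw [hW, div_mul_eq_mul_div, le_div_iff₀ hpos]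
    rw [add_assoc] at h2
    nlinarith
  have hlow : W * (T + (-M - c)) ^ d ≤ N₀ + ((polarLatticePoints G T₀ T).ncard : ℝ) := by
    have h1 : _ ≤ (((lattice d ∩ Metric.closedBall 0 (T₀ + M)).ncard +
      (polarLatticePoints G T₀ T).ncard : ℕ) : ℝ) :=
      Nat.cast_le.2 (le_ncard_polarLatticePoints hd hL hL0 hM h0 h2L T)
    push_cast at h1
    have h2 := (hc (T - M) (by linarith)).2 (by linarith)
    have h3 : T + (-M - c) = T - M - c := by ring
    rw [hW, div_mul_eq_mul_div, div_le_iff₀ hpos, h3]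
    nlinarith
  have hN : 0 ≤ N₀ := Nat.cast_nonneg _
  rw [one_mul, Real.norm_of_nonneg (r := _ + _) (by positivity), Real.norm_eq_abs, abs_le]
  have a1 := le_abs_self (W * ((T + (M + c)) ^ d - T ^ d))
  have a2 := neg_abs_le (W * ((T + (-M - c)) ^ d - T ^ d))
  have a3 := abs_nonneg (W * ((T + (M + c)) ^ d - T ^ d))
  have a4 := abs_nonneg (W * ((T + (-M - c)) ^ d - T ^ d))
  constructor <;> linarith

/-! ### From orthogeodesics to lattice points -/

/-- The flow preserves the direction, so both graphs are evaluated at the same `θ`, and only the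
base points must agree modulo the lattice. -/
theorem orthogeodesics_eq_image {d : ℕ} {σ₁ σ₂ : NormalSign}
    {K₁ K₂ : Set (EuclideanSpace ℝ (Fin d))} {g₁ g₂ : UnitSphere d → EuclideanSpace ℝ (Fin d)}
    (h₁ : normalBundle σ₁ K₁ = range fun θ => (proj (g₁ θ), θ))
    (h₂ : normalBundle σ₂ K₂ = range fun θ => (proj (g₂ θ), θ)) (t : ℝ) :
    orthogeodesics σ₁ σ₂ K₁ K₂ t = (fun θ => (proj (g₁ θ), θ)) ''
      {θ | polarShift (fun θ => g₁ θ - g₂ θ) (t, θ) ∈ lattice d} := by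
  have hadd : ∀ θ : UnitSphere d, proj (g₂ θ) + proj (t • (θ : EuclideanSpace ℝ (Fin d))) =
      proj (g₁ θ) ↔ polarShift (fun θ => g₁ θ - g₂ θ) (t, θ) ∈ lattice d := by
    intro θ
    have : proj (g₂ θ) + proj (t • (θ : EuclideanSpace ℝ (Fin d))) =
        proj (g₂ θ + t • (θ : EuclideanSpace ℝ (Fin d))) := by
      ext i
      simp [proj]
    rw [this, proj_eq_proj_iff]
    have h : g₂ θ + t • (θ : EuclideanSpace ℝ (Fin d)) - g₁ θ =
        polarShift (fun θ => g₁ θ - g₂ θ) (t, θ) := by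
      simp only [polarShift]; abel
    rw [h]
  rw [orthogeodesics, h₁, h₂, ← range_comp]
  ext ⟨p, θ⟩
  simp only [geodesicFlow, mem_inter_iff, mem_range, Function.comp_apply, Prod.mk.injEq, mem_image,
    exists_eq_right, mem_ofPred_eq, ← hadd]
  constructor
  · rintro ⟨rfl, h⟩
    exact ⟨θ, h, rfl, rfl⟩
  · rintro ⟨θ', h, rfl, rfl⟩
    exact ⟨rfl, h⟩

theorem polarLatticePoints_eq_biUnion {d : ℕ} (G : UnitSphere d → EuclideanSpace ℝ (Fin d))
    (T₀ T : ℝ) : polarLatticePoints G T₀ T = ⋃ t ∈ {t | t ∈ Icc T₀ T ∧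
      {θ | polarShift G (t, θ) ∈ lattice d}.Nonempty},
        Prod.mk t '' {θ | polarShift G (t, θ) ∈ lattice d} := by
  ext ⟨t, θ⟩
  simp only [polarLatticePoints, mem_iUnion, mem_image, mem_ofPred_eq, Prod.mk.injEq, exists_prop]
  constructor
  · rintro ⟨ht, h⟩
    exact ⟨t, ⟨ht, θ, h⟩, θ, h, rfl, rfl⟩
  · rintro ⟨t, ⟨ht, -⟩, θ, h, rfl, rfl⟩
    exact ⟨ht, h⟩

theorem finite_times_of_finite_polarLatticePoints {d : ℕ}
    {G : UnitSphere d → EuclideanSpace ℝ (Fin d)} {T₀ T : ℝ}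
    (hfin : (polarLatticePoints G T₀ T).Finite) :
    {t | t ∈ Icc T₀ T ∧ {θ | polarShift G (t, θ) ∈ lattice d}.Nonempty}.Finite := by
  refine (hfin.image Prod.fst).subset ?_
  rintro t ⟨ht, θ, hθ⟩
  exact ⟨(t, θ), ⟨ht, hθ⟩, rfl⟩

theorem finite_directions_of_finite_polarLatticePoints {d : ℕ}
    {G : UnitSphere d → EuclideanSpace ℝ (Fin d)} {T₀ T t : ℝ}
    (hfin : (polarLatticePoints G T₀ T).Finite) (ht : t ∈ Icc T₀ T) :
    {θ | polarShift G (t, θ) ∈ lattice d}.Finite := by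
  have hmaps : MapsTo (Prod.mk t) {θ | polarShift G (t, θ) ∈ lattice d}
      (polarLatticePoints G T₀ T) := fun θ hθ => ⟨ht, hθ⟩
  exact Finite.of_injOn hmaps (Prod.mk_right_injective t).injOn hfin

/-- Fibration of the parameter set over `t`. Only finitely many fibres are nonempty and each is
finite, so neither `finsum` nor `ncard` takes its default value `0`. -/
theorem finsum_ncard_directions {d : ℕ} {G : UnitSphere d → EuclideanSpace ℝ (Fin d)} {T₀ T : ℝ}
    (hfin : (polarLatticePoints G T₀ T).Finite) :
    ∑ᶠ t ∈ Icc T₀ T, {θ | polarShift G (t, θ) ∈ lattice d}.ncard =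
      (polarLatticePoints G T₀ T).ncard := by
  have hI := finite_times_of_finite_polarLatticePoints hfin
  have hΘ : ∀ t ∈ Icc T₀ T, {θ | polarShift G (t, θ) ∈ lattice d}.Finite := fun t ht =>
    finite_directions_of_finite_polarLatticePoints hfin ht
  conv_rhs => rw [polarLatticePoints_eq_biUnion]
  rw [hI.ncard_biUnion (fun t ht => (hΘ t ht.1).image _)]
  · simp only [(Prod.mk_right_injective _).injOn.ncard_image]
    refine finsum_mem_inter_support_eq _ _ _ ?_
    ext t
    simp only [mem_inter_iff, Function.mem_support, mem_ofPred_eq]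
    constructor
    · rintro ⟨ht, hne⟩
      exact ⟨⟨ht, nonempty_of_ncard_ne_zero hne⟩, hne⟩
    · rintro ⟨⟨ht, -⟩, hne⟩
      exact ⟨ht, hne⟩
  · intro s _ t _ hst
    rw [Function.onFun, Set.disjoint_left]
    rintro _ ⟨θ, -, rfl⟩ ⟨θ', -, h⟩
    exact hst (Prod.ext_iff.1 h).1.symm

end Orthogeodesic

theorem theorem8 (d : ℕ) (hd : 2 ≤ d)
    (S₁ S₂ : Set (Torus d)) (K₁ K₂ : Set (EuclideanSpace ℝ (Fin d)))
    (h₁ : IsAdmissibleVia S₁ K₁) (h₂ : IsAdmissibleVia S₂ K₂)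
    (σ₁ σ₂ : NormalSign) :
    ∃ T₀ : ℝ, 0 < T₀ ∧
      (∀ t : ℝ, T₀ ≤ t → (orthogeodesics σ₁ σ₂ K₁ K₂ t).Finite) ∧
      (∀ T : ℝ, {t : ℝ | t ∈ Icc T₀ T ∧ (orthogeodesics σ₁ σ₂ K₁ K₂ t).Nonempty}.Finite) ∧
      (fun T : ℝ =>
          ((∑ᶠ t ∈ Icc T₀ T, (orthogeodesics σ₁ σ₂ K₁ K₂ t).ncard : ℕ) : ℝ) -
            π ^ ((d : ℝ) / 2) * T ^ d / ((2 * π) ^ d * Real.Gamma ((d : ℝ) / 2 + 1)))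
        =O[atTop] fun T : ℝ => T ^ (d - 1) := by
  obtain ⟨g₁, ⟨L₁, hL₁⟩, ⟨M₁, hM₁⟩, hg₁⟩ := exists_normalBundle_eq_range h₁.1 σ₁
  obtain ⟨g₂, ⟨L₂, hL₂⟩, ⟨M₂, hM₂⟩, hg₂⟩ := exists_normalBundle_eq_range h₂.1 σ₂
  set G : UnitSphere d → EuclideanSpace ℝ (Fin d) := fun θ => g₁ θ - g₂ θ
  -- The absolute value supplies the nonnegativity that the given Lipschitz bounds do not assert.
  set L := |L₁ + L₂|
  have hL0 : 0 ≤ L := abs_nonneg _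
  have hL : ∀ θ θ', ‖G θ - G θ'‖ ≤ L * dist θ θ' := fun θ θ' => calc
    ‖G θ - G θ'‖ = ‖(g₁ θ - g₁ θ') - (g₂ θ - g₂ θ')‖ := by rw [sub_sub_sub_comm]
    _ ≤ (L₁ + L₂) * dist θ θ' :=
      (norm_sub_le _ _).trans ((add_le_add (hL₁ θ θ') (hL₂ θ θ')).trans_eq (add_mul _ _ _).symm)
    _ ≤ L * dist θ θ' := mul_le_mul_of_nonneg_right (le_abs_self _) dist_nonneg
  have hM : ∀ θ, ‖G θ‖ ≤ M₁ + M₂ := fun θ =>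
    (norm_sub_le _ _).trans (add_le_add (hM₁ θ) (hM₂ θ))
  -- Any positive `T₀ > 2L` would serve.
  have h0 : 0 < 2 * L + 1 := by positivity
  have h2L : 2 * L < 2 * L + 1 := lt_add_one _
  have horth := orthogeodesics_eq_image hg₁ hg₂
  have hfin := finite_polarLatticePoints hL hM h0 h2L
  have hcard : ∀ t, (orthogeodesics σ₁ σ₂ K₁ K₂ t).ncard =
      {θ | polarShift G (t, θ) ∈ lattice d}.ncard := fun t => by
    rw [horth]
    exact InjOn.ncard_image fun θ _ θ' _ h => (Prod.ext_iff.1 h).2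
  refine ⟨2 * L + 1, h0, fun t ht => ?_, fun T => ?_, ?_⟩
  · rw [horth]
    exact (finite_directions_of_finite_polarLatticePoints (hfin t) ⟨ht, le_rfl⟩).image _
  · simp only [horth, image_nonempty]
    exact finite_times_of_finite_polarLatticePoints (hfin T)
  · simp only [hcard, finsum_ncard_directions (hfin _)]
    exact isBigO_ncard_polarLatticePoints (by omega) hL hL0 hM h0 h2L
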